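/- Let $m\le n$ be positive integers. Let $\mathcal X\subset\{0,1\}^{n\times m}$ be the set of subpermutation matrices, i.e. those $X$ with $\sum_{i=1}^n X_{i,j}=1$ for every position $j\in[m]$ and $\sum_{j=1}^m X_{i,j}\le 1$ for every item $i\in[n]$, let $\mathrm{Conv}(\mathcal X)$ be its convex hull, and write $\langle x,y\rangle=\sum_{i,j}x_{i,j}y_{i,j}$. In each round $t=1,2,\dots$ the environment secretly chooses a loss matrix $\ell_t\in\{0,1\}^{n\times m}$ (for instance, all loss matrices are chosen, arbitrarily and possibly at random, before the game), the learner plays $X_t\in\mathcal X$, suffers the loss $\langle X_t,\ell_t\rangle$ and observes $\ell_{t,i,j}$ for those $(i,j)$ with $X_{t,i,j}=1$. The algorithm FTRL-PBM is the following. Let $\Psi(x)=-\sum_{i,j}\sqrt{x_{i,j}}$ (the $1/2$-Tsallis entropy), $\eta_t=1/(2\sqrt t)$ and $\hat L_0=0$. In round $t$ compute $$x_t=\operatorname*{arg\,min}_{x\in\mathrm{Conv}(\mathcal X)}\ \langle x,\hat L_{t-1}\rangle+\frac1{\eta_t}\Psi(x),$$ draw $X_t\sim P(x_t)$ with fresh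 randomness (that is, conditionally on $\ell_1,X_1,\dots,\ell_{t-1},X_{t-1},\ell_t$, the law of $X_t$ is $P(x_t)$), where for each $x\in\mathrm{Conv}(\mathcal X)$, $P(x)$ is a probability distribution on $\mathcal X$ with $\mathbb E_{X\sim P(x)}[X]=x$, and set $$\hat\ell_{t,i,j}=\frac{\ell_{t,i,j}\,\mathbf 1\{X_{t,i,j}=1\}}{x_{t,i,j}},\qquad \hat L_t=\hat L_{t-1}+\hat\ell_t .$$ The algorithm does not know the horizon. Then for every horizon $T\ge1$, every $x^*\in\operatorname{arg\,min}_{x\in\mathcal X}\mathbb E\big[\sum_{t=1}^T\langle x,\ell_t\rangle\big]$, and with $I^*_j$ the item that $x^*$ places at position $j$ (so $x^*_{I^*_j,j}=1$), the pseudo-regret $R(T)=\mathbb E\big[\sum_{t=1}^T\langle X_t-x^*,\ell_t\rangle\big]$ of FTRL-PBM satisfies $$R(T)\ \le\ 3m+2m\log T+\sum_{t=1}^T\frac{3}{\sqrt t}\sum_{j=1}^m\sum_{i\ne I^*_j}\sqrt{\mathbb E[x_{t,i,j}]}\ \le\ C\,m\sqrt{nT},$$ where $C$ is an absolute constant; in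 particular $R(T)=O(m\sqrt{nT})$. -/

import Mathlib

open MeasureTheory ProbabilityTheory

namespace PBM

/-- `n × m` real matrices; the entry `(i, j)` belongs to item `i` and position `j`. -/
abbrev Mat (n m : ℕ) : Type := Fin n → Fin m → ℝ

/-- The action set `𝒳`: the `n × m` subpermutation matrices. -/
def actions (n m : ℕ) : Set (Mat n m) :=
  {X | (∀ i j, X i j = 0 ∨ X i j = 1) ∧ (∀ j, ∑ i, X i j = 1) ∧ (∀ i, ∑ j, X i j ≤ 1)}

theorem actions_finite (n m : ℕ) : (actions n m).Finite := by
  have h : (Set.univ.pi fun _ : Fin n => Set.univ.pi fun _ : Fin m =>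
      ({0, 1} : Set ℝ)).Finite :=
    Set.Finite.pi fun _ => Set.Finite.pi fun _ => Set.toFinite _
  refine h.subset ?_
  intro X hX i _ j _
  exact hX.1 i j

noncomputable instance (n m : ℕ) : Fintype (actions n m) := (actions_finite n m).fintype

/-- The entrywise inner product of two matrices. -/
def dot {n m : ℕ} (x y : Mat n m) : ℝ := ∑ i, ∑ j, x i j * y i j

/-- The `1/2`-Tsallis entropy `Ψ(x) = ∑ -√x_{i,j}`. -/
noncomputable def tsallis {n m : ℕ} (x : Mat n m) : ℝ := ∑ i, ∑ j, -√(x i j)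

/-- The learning rate `η_t = 1 / (2 √t)`. -/
noncomputable def eta (t : ℕ) : ℝ := 1 / (2 * √(t : ℝ))

/-- `x ∈ argmin_{y ∈ Conv 𝒳} ⟨y, L⟩ + Ψ(y) / η_t`. -/
def IsLeader {n m : ℕ} (t : ℕ) (L x : Mat n m) : Prop :=
  x ∈ convexHull ℝ (actions n m) ∧
    IsMinOn (fun y => dot y L + 1 / eta t * tsallis y) (convexHull ℝ (actions n m)) x

/-- A sampling rule `P`: for every `x ∈ Conv 𝒳`, `P x` is a distribution on `𝒳` with
`𝔼_{X ∼ P x}[X] = x`. -/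
def IsSamplingRule {n m : ℕ} (P : Mat n m → PMF (actions n m)) : Prop :=
  ∀ x ∈ convexHull ℝ (actions n m), ∀ i j,
    ∑ A : actions n m, (P x A).toReal * (A : Mat n m) i j = x i j

section Run

variable {Ω : Type*} {n m : ℕ}

/-- The importance-weighted loss estimate
`ℓ̂_{t,i,j} = ℓ_{t,i,j} 1{X_{t,i,j} = 1} / x_{t,i,j}`. -/
noncomputable def lossEst (ℓ : ℕ → Ω → Mat n m) (X : ℕ → Ω → actions n m)
    (x : ℕ → Ω → Mat n m) (t : ℕ) (ω : Ω) : Mat n m :=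
  fun i j => ℓ t ω i j * (if (X t ω : Mat n m) i j = 1 then 1 else 0) / x t ω i j

/-- The cumulative loss estimate `L̂_t = ℓ̂_1 + ⋯ + ℓ̂_t` (so `L̂_0 = 0`). -/
noncomputable def cumLossEst (ℓ : ℕ → Ω → Mat n m) (X : ℕ → Ω → actions n m)
    (x : ℕ → Ω → Mat n m) (t : ℕ) (ω : Ω) : Mat n m :=
  ∑ s ∈ Finset.Icc 1 t, lossEst ℓ X x s ω

/-- The σ-algebra generated by `ℓ_1, X_1, …, ℓ_{t-1}, X_{t-1}, ℓ_t`: everything that is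
determined before the learner draws its action of round `t`. -/
abbrev beforeDraw (ℓ : ℕ → Ω → Mat n m) (X : ℕ → Ω → actions n m) (t : ℕ) :
    MeasurableSpace Ω :=
  (⨆ s ∈ Finset.Icc 1 t, MeasurableSpace.comap (ℓ s) inferInstance) ⊔
    (⨆ s ∈ Finset.Ico 1 t, MeasurableSpace.comap (X s) inferInstance)

/-- `ℓ` are the loss matrices, `X` the played actions and `x` the regularized leaders of a run of
FTRL-PBM with sampling rule `P`; rounds are numbered from `1`. The learner has no horizon
parameter. The environment is arbitrary: its loss matrices may be fixed or random, and the last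
clause only says that the draw of `X_t` uses fresh randomness; it holds in particular when all
loss matrices are chosen before the game. -/
structure IsRun [MeasurableSpace Ω] (μ : Measure Ω) (P : Mat n m → PMF (actions n m))
    (ℓ : ℕ → Ω → Mat n m) (X : ℕ → Ω → actions n m) (x : ℕ → Ω → Mat n m) : Prop where
  measurable_loss : ∀ t, 1 ≤ t → Measurable (ℓ t)
  measurable_action : ∀ t, 1 ≤ t → Measurable (X t)
  loss_binary : ∀ t, 1 ≤ t → ∀ ω i j, ℓ t ω i j = 0 ∨ ℓ t ω i j = 1
  leader : ∀ t, 1 ≤ t → ∀ ω, IsLeader t (cumLossEst ℓ X x (t - 1) ω) (x t ω)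
  /-- Given the past and the current loss matrix, `X_t` has law `P(x_t)`. -/
  sample : ∀ t, 1 ≤ t → ∀ A : actions n m,
    μ[Set.indicator {ω | X t ω = A} (fun _ => (1 : ℝ)) | beforeDraw ℓ X t]
      =ᵐ[μ] fun ω => (P (x t ω) A).toReal

/-- `x* ∈ argmin_{y ∈ 𝒳} 𝔼[∑_{t=1}^T ⟨y, ℓ_t⟩]`. -/
def IsBestAction [MeasurableSpace Ω] (μ : Measure Ω) (ℓ : ℕ → Ω → Mat n m) (T : ℕ)
    (xs : Mat n m) : Prop :=
  xs ∈ actions n m ∧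
    IsMinOn (fun y => ∫ ω, ∑ t ∈ Finset.Icc 1 T, dot y (ℓ t ω) ∂μ) (actions n m) xs

/-- The pseudo-regret `𝔼[∑_{t=1}^T ⟨X_t - x*, ℓ_t⟩]`. -/
noncomputable def regret [MeasurableSpace Ω] (μ : Measure Ω) (ℓ : ℕ → Ω → Mat n m)
    (X : ℕ → Ω → actions n m) (xs : Mat n m) (T : ℕ) : ℝ :=
  ∫ ω, ∑ t ∈ Finset.Icc 1 T, dot ((X t ω : Mat n m) - xs) (ℓ t ω) ∂μ

/-- The regret bound
`3m + 2m log T + ∑_{t=1}^T (3/√t) ∑_j ∑_{i ≠ I*_j} √𝔼[x_{t,i,j}]`. -/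
noncomputable def regretBound [MeasurableSpace Ω] (μ : Measure Ω) (x : ℕ → Ω → Mat n m)
    (Is : Fin m → Fin n) (T : ℕ) : ℝ :=
  3 * (m : ℝ) + 2 * (m : ℝ) * Real.log (T : ℝ) +
    ∑ t ∈ Finset.Icc 1 T, 3 / √(t : ℝ) *
      ∑ j : Fin m, ∑ i ∈ Finset.univ.erase (Is j), √(∫ ω, x t ω i j ∂μ)

end Run

end PBM

/-!
The regret is bounded by stability plus penalty of follow the regularized leader, run on the loss
estimates.

*Optimality.* Minimality of a leader `x` along segments shows that on `Conv 𝒳` its objective grows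
at least like the Bregman divergence `√t ∑ (√y - √x)² / √x` of `Ψ / η_t` (`IsLeader.add_le`). The
infinite slope of the square root at `0` makes this meaningful also where `x` vanishes
(`IsLeader.eq_zero_of_eq_zero`), and strict growth makes leaders unique. An induction over the
rounds then bounds the estimated regret by the sum over `t` of
`⟨x_t - y, ℓ̂_t⟩ - √t ∑ (√y - √x_t)² / √x_t` at suitable `y ∈ Conv 𝒳` (stability) and of
`2 (√t - √(t - 1)) (Ψ(x*) - Ψ(x_t))` (penalty), see `sum_dot_leader_le`.

*Stability.* Every column of a point of `Conv 𝒳` sums to `1`, so the loss estimate of a position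
may be shifted by a constant. With item `k` drawn and its loss `1`, the shift by `1` and maximization
over each coordinate give a bound `drawCost`; it is also at most `1`, as estimates are nonnegative.
Averaging over `k ∼ x` leaves `(1 / √t) ∑ √x_i (1 - x_i) + 1 / t`, and
`∑ √x_i (1 - x_i) ≤ 2 ∑_{i ≠ i*} √x_i` for any `i*`. Stability and penalty of one position in round
`t` together are at most `(3 / √t) ∑_{i ≠ i*} √x_i + 2 / t`
(`sum_mul_drawCost_add_penalty_le`); the terms `2 / t` sum to the logarithm.

*Probability.* Losses and actions are finitely valued and leaders are unique, so `x_t` is a finitely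
valued function of the past. Measurability and integrability are therefore automatic, and fresh
randomness allows `X_t` to be replaced by `x_t` in expectations against quantities known before the
draw (`IsRun.integral_action_mul`). Jensen's inequality moves the expectation inside the square root,
and the Cauchy–Schwarz inequality gives the final `O(m √(n T))`.
-/

namespace PBM

/-! ### Leaders and the convex hull of the actions -/

section Deterministic

variable {n m : ℕ}

theorem nonneg_and_sum_eq_one_of_mem_convexHull {y : Mat n m}
    (hy : y ∈ convexHull ℝ (actions n m)) :
    (∀ i j, 0 ≤ y i j) ∧ ∀ j, ∑ i, y i j = 1 := by
  have hconv : Convex ℝ {y : Mat n m | (∀ i j, 0 ≤ y i j) ∧ ∀ j, ∑ i, y i j = 1} := by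
    rintro a ⟨ha, ha'⟩ b ⟨hb, hb'⟩ p q hp hq hpq
    refine ⟨fun i j => ?_, fun j => ?_⟩
    · have := mul_nonneg hp (ha i j)
      have := mul_nonneg hq (hb i j)
      simp only [Pi.add_apply, Pi.smul_apply, smul_eq_mul]
      linarith
    · simp only [Pi.add_apply, Pi.smul_apply, smul_eq_mul, Finset.sum_add_distrib,
        ← Finset.mul_sum, ha', hb', mul_one, hpq]
  have hsub : actions n m ⊆ {y : Mat n m | (∀ i j, 0 ≤ y i j) ∧ ∀ j, ∑ i, y i j = 1} := by
    rintro X ⟨h01, hcol, -⟩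
    refine ⟨fun i j => ?_, hcol⟩
    rcases h01 i j with h | h <;> simp [h]
  exact convexHull_min hsub hconv hy

theorem nonneg_of_mem_convexHull {y : Mat n m} (hy : y ∈ convexHull ℝ (actions n m)) (i j) :
    0 ≤ y i j :=
  (nonneg_and_sum_eq_one_of_mem_convexHull hy).1 i j

theorem sum_eq_one_of_mem_convexHull {y : Mat n m} (hy : y ∈ convexHull ℝ (actions n m)) (j) :
    ∑ i, y i j = 1 :=
  (nonneg_and_sum_eq_one_of_mem_convexHull hy).2 j

theorem le_one_of_mem_convexHull {y : Mat n m} (hy : y ∈ convexHull ℝ (actions n m)) (i j) :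
    y i j ≤ 1 := by
  rw [← sum_eq_one_of_mem_convexHull hy j]
  exact Finset.single_le_sum (f := fun i => y i j)
    (fun k _ => nonneg_of_mem_convexHull hy k j) (Finset.mem_univ i)

theorem one_div_eta (t : ℕ) : 1 / eta t = 2 * √(t : ℝ) := by
  simp [eta]

theorem dot_sub_left (x y L : Mat n m) : dot (x - y) L = dot x L - dot y L := by
  simp [dot, sub_mul, Finset.sum_sub_distrib]

theorem dot_add_right (x L K : Mat n m) : dot x (L + K) = dot x L + dot x K := by
  simp [dot, mul_add, Finset.sum_add_distrib]

theorem dot_add_smul_left (x d L : Mat n m) (h : ℝ) :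
    dot (x + h • d) L = dot x L + h * dot d L := by
  simp [dot, add_mul, Finset.sum_add_distrib, Finset.mul_sum, mul_assoc]

/-- Minimality along the segment from the leader `x` to `y`, divided by the step `h`. -/
theorem IsLeader.sum_slope_le {t : ℕ} {L x y : Mat n m} (hx : IsLeader t L x)
    (hy : y ∈ convexHull ℝ (actions n m)) {h : ℝ} (h0 : 0 < h) (h1 : h ≤ 1) :
    2 * √(t : ℝ) * ∑ i, ∑ j, h⁻¹ * (√(x i j + h * (y i j - x i j)) - √(x i j))
      ≤ dot (y - x) L := by
  have hz : x + h • (y - x) ∈ convexHull ℝ (actions n m) :=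
    (convex_convexHull ℝ _).add_smul_sub_mem hx.1 hy ⟨h0.le, h1⟩
  have hmin := hx.2 hz
  simp only [Set.mem_ofPred_eq, one_div_eta, dot_add_smul_left] at hmin
  have hts : tsallis (x + h • (y - x)) = tsallis x -
      h * ∑ i, ∑ j, h⁻¹ * (√(x i j + h * (y i j - x i j)) - √(x i j)) := by
    simp only [tsallis, ← Finset.mul_sum, mul_inv_cancel_left₀ h0.ne', Finset.sum_sub_distrib,
      Finset.sum_neg_distrib, Pi.add_apply, Pi.smul_apply, Pi.sub_apply, smul_eq_mul]
    ring
  rw [hts] at hmin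
  refine le_of_mul_le_mul_left ?_ h0
  linarith

theorem sqrt_sub_sqrt_le_slope {a b h : ℝ} (ha : 0 ≤ a) (hb : 0 ≤ b) (h0 : 0 < h) (h1 : h ≤ 1) :
    √b - √a ≤ h⁻¹ * (√(a + h * (b - a)) - √a) := by
  rw [le_inv_mul_iff₀ h0]
  have : (1 - h) * √a + h * √b ≤ √((1 - h) * a + h * b) :=
    Real.strictConcaveOn_sqrt.concaveOn.2 (Set.mem_Ici.2 ha) (Set.mem_Ici.2 hb)
      (sub_nonneg.2 h1) h0.le (sub_add_cancel 1 h)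
  rw [show a + h * (b - a) = (1 - h) * a + h * b by ring]
  linarith

/-- The entropy has infinite slope at the boundary, so a leader vanishes only at entries where all
of `Conv 𝒳` vanishes. -/
theorem IsLeader.eq_zero_of_eq_zero {t : ℕ} (ht : 1 ≤ t) {L x y : Mat n m} (hx : IsLeader t L x)
    (hy : y ∈ convexHull ℝ (actions n m)) {i : Fin n} {j : Fin m} (h0 : x i j = 0) :
    y i j = 0 := by
  by_contra hne
  have hyp : 0 < y i j := lt_of_le_of_ne (nonneg_of_mem_convexHull hy i j) (Ne.symm hne)
  have hr : 0 < √(t : ℝ) := Real.sqrt_pos.2 (by exact_mod_cast ht)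
  set s : ℝ := √(y i j) with hs
  have hsp : 0 < s := Real.sqrt_pos.2 hyp
  set K : ℝ := dot (y - x) L / (2 * √(t : ℝ)) + s - ∑ a, ∑ b, (√(y a b) - √(x a b)) with hK
  -- The slope at `(i, j)` is `s / √h`, the others are at least their values at `h = 1`.
  have key : ∀ u : ℝ, 1 ≤ u → s * u ≤ K := by
    intro u hu
    have hu0 : 0 < u := by linarith
    have hh0 : 0 < (u ^ 2)⁻¹ := by positivity
    have hh1 : (u ^ 2)⁻¹ ≤ 1 := inv_le_one_of_one_le₀ (by nlinarith)
    have h1 := hx.sum_slope_le hy hh0 hh1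
    rw [mul_comm, ← le_div_iff₀ (by positivity)] at h1
    have hslope : ((u ^ 2)⁻¹)⁻¹ * (√(x i j + (u ^ 2)⁻¹ * (y i j - x i j)) - √(x i j)) = s * u := by
      rw [h0, Real.sqrt_zero, zero_add, sub_zero, sub_zero, Real.sqrt_mul hh0.le, Real.sqrt_inv,
        Real.sqrt_sq hu0.le, ← hs]
      field_simp
    have h2 : (s * u - s) ≤ ∑ a, ∑ b, (((u ^ 2)⁻¹)⁻¹ *
        (√(x a b + (u ^ 2)⁻¹ * (y a b - x a b)) - √(x a b)) - (√(y a b) - √(x a b))) := by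
      have hnn : ∀ a b, 0 ≤ ((u ^ 2)⁻¹)⁻¹ *
          (√(x a b + (u ^ 2)⁻¹ * (y a b - x a b)) - √(x a b)) - (√(y a b) - √(x a b)) :=
        fun a b => sub_nonneg.2 (sqrt_sub_sqrt_le_slope (nonneg_of_mem_convexHull hx.1 a b)
          (nonneg_of_mem_convexHull hy a b) hh0 hh1)
      have e : s * u - s = ((u ^ 2)⁻¹)⁻¹ *
          (√(x i j + (u ^ 2)⁻¹ * (y i j - x i j)) - √(x i j)) - (√(y i j) - √(x i j)) := by
        rw [hslope, h0, Real.sqrt_zero, sub_zero]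
      rw [e]
      refine le_trans ?_ (Finset.single_le_sum (f := fun a => ∑ b, (((u ^ 2)⁻¹)⁻¹ *
        (√(x a b + (u ^ 2)⁻¹ * (y a b - x a b)) - √(x a b)) - (√(y a b) - √(x a b))))
        (fun a _ => Finset.sum_nonneg fun b _ => hnn a b) (Finset.mem_univ i))
      exact Finset.single_le_sum (f := fun b => (((u ^ 2)⁻¹)⁻¹ *
        (√(x i b + (u ^ 2)⁻¹ * (y i b - x i b)) - √(x i b)) - (√(y i b) - √(x i b))))
        (fun b _ => hnn i b) (Finset.mem_univ j)
    simp only [Finset.sum_sub_distrib (f := fun b => ((u ^ 2)⁻¹)⁻¹ *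
        (√(x _ b + (u ^ 2)⁻¹ * (y _ b - x _ b)) - √(x _ b)))] at h2
    rw [Finset.sum_sub_distrib] at h2
    linarith
  have h3 := key (|K| / s + 1) (by have : 0 ≤ |K| / s := by positivity
                                   linarith)
  rw [mul_add, mul_div_cancel₀ _ hsp.ne'] at h3
  have := le_abs_self K
  linarith

/-- First-order optimality: on `Conv 𝒳` the objective grows away from the leader at least like the
Bregman divergence of `Ψ / η_t`, which is `√t ∑ (√y - √x)² / √x`. Entries with `x = 0` contribute
`0` on both sides. -/
theorem IsLeader.add_le {t : ℕ} (ht : 1 ≤ t) {L x y : Mat n m} (hx : IsLeader t L x)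
    (hy : y ∈ convexHull ℝ (actions n m)) :
    dot x L + 2 * √(t : ℝ) * tsallis x
        + √(t : ℝ) * ∑ i, ∑ j, (√(y i j) - √(x i j)) ^ 2 / √(x i j)
      ≤ dot y L + 2 * √(t : ℝ) * tsallis y := by
  have hlim : Filter.Tendsto (fun h : ℝ => 2 * √(t : ℝ) *
      ∑ i, ∑ j, h⁻¹ * (√(x i j + h * (y i j - x i j)) - √(x i j))) (nhdsWithin 0 (Set.Ioi 0))
      (nhds (2 * √(t : ℝ) * ∑ i, ∑ j, (y i j - x i j) / (2 * √(x i j)))) := by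
    refine Filter.Tendsto.const_mul _ (tendsto_finsetSum _ fun i _ => ?_)
    refine tendsto_finsetSum _ fun j _ => ?_
    rcases (nonneg_of_mem_convexHull hx.1 i j).eq_or_lt with h0 | hpos
    · simp [← h0, hx.eq_zero_of_eq_zero ht hy h0.symm]
    · have hd : HasDerivAt (fun h : ℝ => √(x i j + h * (y i j - x i j)))
          ((y i j - x i j) / (2 * √(x i j))) 0 := by
        have h1 : HasDerivAt (fun h : ℝ => x i j + h * (y i j - x i j)) (y i j - x i j) 0 := by
          simpa using ((hasDerivAt_id (0 : ℝ)).mul_const (y i j - x i j)).const_add (x i j)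
        simpa using h1.sqrt (by simpa using hpos.ne')
      simpa using hd.tendsto_slope_zero_right
  have hle := le_of_tendsto hlim (by
    filter_upwards [Ioc_mem_nhdsGT (zero_lt_one (α := ℝ))] with h hh
    exact hx.sum_slope_le hy hh.1 hh.2)
  rw [dot_sub_left] at hle
  have e : ∑ i, ∑ j, (√(y i j) - √(x i j)) ^ 2 / √(x i j)
      = 2 * ∑ i, ∑ j, (y i j - x i j) / (2 * √(x i j)) + 2 * (tsallis y - tsallis x) := by
    simp only [tsallis, ← Finset.sum_sub_distrib, Finset.mul_sum, ← Finset.sum_add_distrib]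
    refine Finset.sum_congr rfl fun i _ => Finset.sum_congr rfl fun j _ => ?_
    rcases (nonneg_of_mem_convexHull hx.1 i j).eq_or_lt with h0 | hpos
    · simp [← h0, hx.eq_zero_of_eq_zero ht hy h0.symm]
    · have h1 := Real.sq_sqrt hpos.le
      have h2 := Real.sq_sqrt (nonneg_of_mem_convexHull hy i j)
      have h3 := Real.sqrt_pos.2 hpos
      set s := √(x i j)
      set u := √(y i j)
      rw [← h1, ← h2]
      field_simp
      ring
  rw [e]
  linarith

theorem IsLeader.unique {t : ℕ} (ht : 1 ≤ t) {L x y : Mat n m} (hx : IsLeader t L x)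
    (hy : IsLeader t L y) : x = y := by
  have hr : 0 < √(t : ℝ) := Real.sqrt_pos.2 (by exact_mod_cast ht)
  have h1 := hx.add_le ht hy.1
  have h2 := hy.2 hx.1
  simp only [Set.mem_ofPred_eq, one_div_eta] at h2
  have h3 : ∑ i, ∑ j, (√(y i j) - √(x i j)) ^ 2 / √(x i j) ≤ 0 := by
    by_contra hc
    have := mul_pos hr (not_le.1 hc)
    linarith
  have hnn : ∀ i j, 0 ≤ (√(y i j) - √(x i j)) ^ 2 / √(x i j) := fun i j => by positivity
  have h4 := le_antisymm h3 (Finset.sum_nonneg fun i _ => Finset.sum_nonneg fun j _ => hnn i j)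
  rw [Finset.sum_eq_zero_iff_of_nonneg fun i _ => Finset.sum_nonneg fun j _ => hnn i j] at h4
  ext i j
  have h5 := h4 i (Finset.mem_univ i)
  rw [Finset.sum_eq_zero_iff_of_nonneg fun j _ => hnn i j] at h5
  have h6 := h5 j (Finset.mem_univ j)
  rcases (nonneg_of_mem_convexHull hx.1 i j).eq_or_lt with h0 | hpos
  · rw [← h0, hx.eq_zero_of_eq_zero ht hy.1 h0.symm]
  · have h7 := (Real.sqrt_pos.2 hpos).ne'
    have h8 : √(y i j) - √(x i j) = 0 := by
      simpa [h7] using h6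
    exact ((Real.sqrt_inj (nonneg_of_mem_convexHull hy.1 i j) hpos.le).1 (by linarith)).symm

end Deterministic

/-! ### Stability and penalty of one position -/

section Position

/-- Maximization over one coordinate: for `s = √x`, `u = √y`, the left side is a concave quadratic
in `u`, and the right side is its maximum. -/
theorem coord_stability_le {r s u v : ℝ} (h0 : s = 0 → u = 0) (hs : 0 ≤ s) (hq : 0 < r + s * v) :
    (s ^ 2 - u ^ 2) * v - r * ((u - s) ^ 2 / s) ≤ s ^ 3 * v ^ 2 / (r + s * v) := by
  rcases hs.eq_or_lt with h | h
  · simp [← h, h0 h.symm]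
  · rw [← sub_nonneg]
    have e : s ^ 3 * v ^ 2 / (r + s * v) - ((s ^ 2 - u ^ 2) * v - r * ((u - s) ^ 2 / s))
        = s / (r + s * v) * (s * v + (u - s) / s * (r + s * v)) ^ 2 := by
      field_simp
      ring
    rw [e]
    positivity

/-- Contribution of an item that was not drawn to the stability of a position, when it has
probability `x` in round `t`. -/
noncomputable def idleCost (t : ℕ) (x : ℝ) : ℝ := √x ^ 3 / √(t : ℝ) + 4 * x ^ 2 / t

theorem idleCost_nonneg (t : ℕ) (x : ℝ) : 0 ≤ idleCost t x := by
  unfold idleCost; positivity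

variable {ι : Type*} [Fintype ι]

theorem le_one_of_sum_eq_one {x : ι → ℝ} (hx0 : ∀ i, 0 ≤ x i) (hx1 : ∑ i, x i = 1) (i : ι) :
    x i ≤ 1 := by
  rw [← hx1]
  exact Finset.single_le_sum (fun k _ => hx0 k) (Finset.mem_univ i)

variable [DecidableEq ι]

/-- Upper bound for the stability of a position in round `t` when item `k` is drawn from the
distribution `x` and has loss `1`. The first round is only bounded by `1`. -/
noncomputable def drawCost (t : ℕ) (x : ι → ℝ) (k : ι) : ℝ :=
  if t = 1 then 1 else
    min 1 ((1 - x k) ^ 2 / (√(x k) * √(t : ℝ)) + ∑ i ∈ Finset.univ.erase k, idleCost t (x i))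

theorem drawCost_nonneg (t : ℕ) (x : ι → ℝ) (k : ι) : 0 ≤ drawCost t x k := by
  unfold drawCost
  split_ifs
  · norm_num
  · refine le_min zero_le_one (add_nonneg (by positivity) (Finset.sum_nonneg fun i _ => ?_))
    exact idleCost_nonneg t _

theorem four_thirds_le_sqrt {t : ℕ} (ht : 2 ≤ t) : 4 / 3 ≤ √(t : ℝ) := by
  apply Real.le_sqrt_of_sq_le
  have : (2 : ℝ) ≤ t := by exact_mod_cast ht
  linarith

/-- Stability of one position in which the item `k` with loss `1` is drawn. Since `x` and `y` have
the same total, the loss estimate `1 / x k` at `k` may be shifted to `1 / x k - 1` at `k` and `-1`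
elsewhere, which makes the coordinatewise bounds small enough. -/
theorem stability_le_drawCost {t : ℕ} (ht : 1 ≤ t) {x y : ι → ℝ} (hx0 : ∀ i, 0 ≤ x i)
    (hx1 : ∑ i, x i = 1) (hy0 : ∀ i, 0 ≤ y i) (hy1 : ∑ i, y i = 1) (hxy : ∀ i, x i = 0 → y i = 0)
    {k : ι} (hk : x k ≠ 0) :
    (x k - y k) / x k - √(t : ℝ) * ∑ i, (√(y i) - √(x i)) ^ 2 / √(x i) ≤ drawCost t x k := by
  have hkp : 0 < x k := lt_of_le_of_ne (hx0 k) (Ne.symm hk)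
  have hone : (x k - y k) / x k - √(t : ℝ) * ∑ i, (√(y i) - √(x i)) ^ 2 / √(x i) ≤ 1 := by
    have h1 : (x k - y k) / x k ≤ 1 := by
      rw [div_le_one hkp]
      linarith [hy0 k]
    have h2 : 0 ≤ √(t : ℝ) * ∑ i, (√(y i) - √(x i)) ^ 2 / √(x i) :=
      mul_nonneg (by positivity) (Finset.sum_nonneg fun i _ => by positivity)
    linarith
  unfold drawCost
  split_ifs with ht1
  · exact hone
  refine le_min hone ?_
  have hr := four_thirds_le_sqrt (t := t) (by omega)
  set r : ℝ := √(t : ℝ) with hrdef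
  have hrt : r ^ 2 = t := Real.sq_sqrt (Nat.cast_nonneg t)
  have hs1 : ∀ i, √(x i) ≤ 1 := fun i => Real.sqrt_le_one.2 (le_one_of_sum_eq_one hx0 hx1 i)
  have hsu : ∀ i, √(x i) = 0 → √(y i) = 0 := fun i h => by
    rw [hxy i ((Real.sqrt_eq_zero (hx0 i)).1 h), Real.sqrt_zero]
  have hk1 := le_one_of_sum_eq_one hx0 hx1 k
  -- The drawn item.
  have hdraw : (x k - y k) * (1 / x k - 1) - r * ((√(y k) - √(x k)) ^ 2 / √(x k))
      ≤ (1 - x k) ^ 2 / (√(x k) * r) := by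
    have hv : 0 ≤ 1 / x k - 1 := sub_nonneg.2 (by rw [le_div_iff₀ hkp]; linarith)
    have hsk := Real.sqrt_pos.2 hkp
    have h1 := coord_stability_le (r := r) (v := 1 / x k - 1) (hsu k) (Real.sqrt_nonneg _)
      (by positivity)
    rw [Real.sq_sqrt (hx0 k), Real.sq_sqrt (hy0 k)] at h1
    refine h1.trans ?_
    have h2 : √(x k) ^ 3 * (1 / x k - 1) ^ 2 / (r + √(x k) * (1 / x k - 1))
        ≤ √(x k) ^ 3 * (1 / x k - 1) ^ 2 / r := by
      apply div_le_div_of_nonneg_left (by positivity) (by positivity)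
      have : 0 ≤ √(x k) * (1 / x k - 1) := by positivity
      linarith
    refine h2.trans (le_of_eq ?_)
    have h3 := Real.sq_sqrt (hx0 k)
    set s := √(x k)
    rw [← h3]
    field_simp
  -- The other items.
  have hidle : ∀ i, (x i - y i) * (-1) - r * ((√(y i) - √(x i)) ^ 2 / √(x i))
      ≤ idleCost t (x i) := by
    intro i
    have h1 := coord_stability_le (r := r) (v := -1) (hsu i) (Real.sqrt_nonneg _)
      (by linarith [hs1 i])
    rw [Real.sq_sqrt (hx0 i), Real.sq_sqrt (hy0 i)] at h1
    refine h1.trans ?_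
    unfold idleCost
    rw [← hrdef, ← hrt]
    have h3 := Real.sq_sqrt (hx0 i)
    have h4 := Real.sqrt_nonneg (x i)
    have h5 := hs1 i
    set s := √(x i)
    rw [← h3, ← sub_nonneg]
    -- The constant `4` in `idleCost` works because `r ≥ 4 / 3 ≥ 4 s / 3`.
    have hq : 0 < r - s := by linarith
    have hq' : r - s ≠ 0 := hq.ne'
    have e : s ^ 3 / r + 4 * (s ^ 2) ^ 2 / r ^ 2 - s ^ 3 * (-1) ^ 2 / (r + s * -1)
        = s ^ 4 * (3 * r - 4 * s) / (r ^ 2 * (r - s)) := by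
      rw [mul_neg_one, ← sub_eq_add_neg]
      field_simp
      ring
    rw [e]
    have : 0 ≤ 3 * r - 4 * s := by linarith
    positivity
  have hsplit : (x k - y k) / x k - r * ∑ i, (√(y i) - √(x i)) ^ 2 / √(x i)
      = ((x k - y k) * (1 / x k - 1) - r * ((√(y k) - √(x k)) ^ 2 / √(x k)))
        + ∑ i ∈ Finset.univ.erase k,
          ((x i - y i) * (-1) - r * ((√(y i) - √(x i)) ^ 2 / √(x i))) := by
    have e1 := Finset.add_sum_erase Finset.univ (fun i => (√(y i) - √(x i)) ^ 2 / √(x i))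
      (Finset.mem_univ k)
    have e2 := Finset.add_sum_erase Finset.univ x (Finset.mem_univ k)
    have e3 := Finset.add_sum_erase Finset.univ y (Finset.mem_univ k)
    rw [Finset.sum_sub_distrib, ← Finset.sum_mul, ← Finset.mul_sum, Finset.sum_sub_distrib, ← e1]
    rw [hx1] at e2
    rw [hy1] at e3
    rw [show ∑ i ∈ Finset.univ.erase k, x i = 1 - x k by linarith,
      show ∑ i ∈ Finset.univ.erase k, y i = 1 - y k by linarith]
    ring
  rw [hsplit]
  exact add_le_add hdraw (Finset.sum_le_sum fun i _ => hidle i)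

theorem sum_sqrt_mul_one_sub_le {x : ι → ℝ} (hx0 : ∀ i, 0 ≤ x i) (hx1 : ∑ i, x i = 1) (k : ι) :
    ∑ i, √(x i) * (1 - x i) ≤ 2 * ∑ i ∈ Finset.univ.erase k, √(x i) := by
  have hle := le_one_of_sum_eq_one hx0 hx1
  have hs1 : ∀ i, √(x i) ≤ 1 := fun i => Real.sqrt_le_one.2 (hle i)
  rw [← Finset.add_sum_erase Finset.univ _ (Finset.mem_univ k)]
  have h1 : √(x k) * (1 - x k) ≤ ∑ i ∈ Finset.univ.erase k, √(x i) := by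
    have e := Finset.add_sum_erase Finset.univ x (Finset.mem_univ k)
    calc √(x k) * (1 - x k) ≤ 1 * (1 - x k) :=
          mul_le_mul_of_nonneg_right (hs1 k) (by linarith [hle k])
      _ = ∑ i ∈ Finset.univ.erase k, x i := by linarith
      _ ≤ _ := Finset.sum_le_sum fun i _ => by
          nlinarith [Real.sq_sqrt (hx0 i), Real.sqrt_nonneg (x i), hs1 i]
  have h2 : ∑ i ∈ Finset.univ.erase k, √(x i) * (1 - x i)
      ≤ ∑ i ∈ Finset.univ.erase k, √(x i) :=
    Finset.sum_le_sum fun i _ => by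
      nlinarith [mul_nonneg (Real.sqrt_nonneg (x i)) (hx0 i)]
  linarith

theorem sum_mul_drawCost_le_one (t : ℕ) {x : ι → ℝ} (hx0 : ∀ i, 0 ≤ x i) (hx1 : ∑ i, x i = 1) :
    ∑ i, x i * drawCost t x i ≤ 1 := by
  calc ∑ i, x i * drawCost t x i ≤ ∑ i, x i * 1 :=
        Finset.sum_le_sum fun i _ => mul_le_mul_of_nonneg_left (by
          unfold drawCost
          split_ifs
          · exact le_rfl
          · exact min_le_left _ _) (hx0 i)
    _ = 1 := by simp [hx1]

theorem sum_mul_drawCost_le {t : ℕ} (ht : 2 ≤ t) {x : ι → ℝ} (hx0 : ∀ i, 0 ≤ x i)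
    (hx1 : ∑ i, x i = 1) (k : ι) :
    ∑ i, x i * drawCost t x i
      ≤ 2 * (∑ i ∈ Finset.univ.erase k, √(x i)) / √(t : ℝ) + 1 / t := by
  have hle := le_one_of_sum_eq_one hx0 hx1
  have hr := four_thirds_le_sqrt ht
  have hrt : √(t : ℝ) ^ 2 = t := Real.sq_sqrt (Nat.cast_nonneg t)
  have htp : (0 : ℝ) < t := by positivity
  calc ∑ i, x i * drawCost t x i
      ≤ ∑ i, (√(x i) * (1 - x i) ^ 2 / √(t : ℝ) + x i * ∑ a, idleCost t (x a)
          - x i * idleCost t (x i)) := by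
        refine Finset.sum_le_sum fun i _ => ?_
        have h1 : drawCost t x i ≤ (1 - x i) ^ 2 / (√(x i) * √(t : ℝ))
            + ∑ a ∈ Finset.univ.erase i, idleCost t (x a) := by
          rw [drawCost, if_neg (by omega)]
          exact min_le_right _ _
        refine (mul_le_mul_of_nonneg_left h1 (hx0 i)).trans (le_of_eq ?_)
        rw [← Finset.add_sum_erase Finset.univ (fun a => idleCost t (x a)) (Finset.mem_univ i)]
        have h2 : x i * ((1 - x i) ^ 2 / (√(x i) * √(t : ℝ)))
            = √(x i) * (1 - x i) ^ 2 / √(t : ℝ) := by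
          rcases (hx0 i).eq_or_lt with h | h
          · simp [← h]
          · have h3 := Real.sqrt_pos.2 h
            have h4 := Real.sq_sqrt h.le
            set s := √(x i)
            rw [← h4]
            field_simp
        rw [mul_add, h2]
        ring
    _ = ∑ i, (√(x i) * (1 - x i) / √(t : ℝ) + 4 * (x i ^ 2 * (1 - x i)) / t) := by
        rw [Finset.sum_sub_distrib, Finset.sum_add_distrib, ← Finset.sum_mul, hx1, one_mul,
          ← Finset.sum_add_distrib, ← Finset.sum_sub_distrib]
        refine Finset.sum_congr rfl fun i _ => ?_
        rw [idleCost, pow_succ √(x i) 2, Real.sq_sqrt (hx0 i)]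
        ring
    _ ≤ ∑ i, (√(x i) * (1 - x i) / √(t : ℝ) + x i / t) := by
        refine Finset.sum_le_sum fun i _ => add_le_add_right ?_ _
        gcongr
        nlinarith [mul_nonneg (hx0 i) (sq_nonneg (2 * x i - 1))]
    _ = (∑ i, √(x i) * (1 - x i)) / √(t : ℝ) + 1 / t := by
        rw [Finset.sum_add_distrib, ← Finset.sum_div, ← Finset.sum_div, hx1]
    _ ≤ _ := by
        gcongr
        exact sum_sqrt_mul_one_sub_le hx0 hx1 k

/-- Expected stability plus penalty of one position in one round. Let `A` be the sum of square roots
divided by `√t`. If `A ≥ 1`, the stability is at most `1 ≤ A` and the penalty at most `2 A`. If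
`A ≤ 1`, the excess of the penalty over `A` is at most `1 / t`. -/
theorem sum_mul_drawCost_add_penalty_le {t : ℕ} (ht : 1 ≤ t) {x : ι → ℝ} (hx0 : ∀ i, 0 ≤ x i)
    (hx1 : ∑ i, x i = 1) (k : ι) :
    ∑ i, x i * drawCost t x i
        + 2 * (√(t : ℝ) - √((t : ℝ) - 1)) * ∑ i ∈ Finset.univ.erase k, √(x i)
      ≤ 3 / √(t : ℝ) * (∑ i ∈ Finset.univ.erase k, √(x i)) + 2 / t := by
  have ht' : (1 : ℝ) ≤ t := by exact_mod_cast ht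
  have hr : 0 < √(t : ℝ) := Real.sqrt_pos.2 (by linarith)
  have hrt : √(t : ℝ) ^ 2 = t := Real.sq_sqrt (by linarith)
  have hqt : √((t : ℝ) - 1) ^ 2 = t - 1 := Real.sq_sqrt (by linarith)
  have hq : 0 ≤ √((t : ℝ) - 1) := Real.sqrt_nonneg _
  have h1 := sum_mul_drawCost_le_one t hx0 hx1
  have h2 := fun h : 2 ≤ t => sum_mul_drawCost_le h hx0 hx1 k
  set D := ∑ i, x i * drawCost t x i
  have hS : 0 ≤ ∑ i ∈ Finset.univ.erase k, √(x i) :=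
    Finset.sum_nonneg fun i _ => Real.sqrt_nonneg _
  set S := ∑ i ∈ Finset.univ.erase k, √(x i)
  set r := √(t : ℝ)
  set q := √((t : ℝ) - 1)
  have hdiff : r - q = 1 / (r + q) := by
    rw [eq_div_iff (by positivity)]
    linarith [show (r - q) * (r + q) = r ^ 2 - q ^ 2 by ring]
  set A := S / r with hA
  have hSA : S = A * r := by rw [hA]; field_simp
  have hA0 : 0 ≤ A := by positivity
  have e3 : 3 / r * S = 3 * A := by rw [hA]; ring
  have hdiv : (0 : ℝ) < 1 / t := by positivity
  rw [e3, show (2 : ℝ) / t = 2 * (1 / t) by ring]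
  have hpen1 : 2 * (r - q) * S ≤ 2 * A := by
    rw [hdiff, hSA]
    have : 1 / (r + q) * r ≤ 1 := by
      rw [one_div, inv_mul_le_iff₀ (by positivity)]
      linarith
    nlinarith
  rcases le_total 1 A with hA1 | hA1
  · linarith
  · rcases ht.eq_or_lt with h | h
    · rw [← h] at hdiv ⊢
      norm_num
      linarith
    · have hpen2 : 2 * (r - q) * S ≤ A + 1 / t := by
        have e : 2 * (r - q) * S = A + A * ((r - q) ^ 2) := by
          rw [hSA]
          have : 2 * (r - q) * r = 1 + (r - q) ^ 2 := by
            linarith [show 2 * (r - q) * r = (r ^ 2 - q ^ 2) + (r - q) ^ 2 by ring]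
          linear_combination A * this
        have h3 : (r - q) ^ 2 ≤ 1 / t := by
          rw [hdiff, div_pow, one_pow, ← hrt]
          apply one_div_le_one_div_of_le (by positivity)
          gcongr
          linarith
        have h4 : A * (r - q) ^ 2 ≤ 1 * (r - q) ^ 2 :=
          mul_le_mul_of_nonneg_right hA1 (sq_nonneg _)
        linarith
      have h5 := h2 h
      rw [show 2 * S / r = 2 * A by rw [hA]; ring] at h5
      linarith

end Position

/-! ### Regret of follow the regularized leader -/

section FTRL

variable {n m : ℕ}

/-- Regret of follow the regularized leader against a fixed point of `Conv 𝒳`, for arbitrary loss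
estimates whose stability is bounded by `stab`. The value `c` is arbitrary here; it becomes the
entropy of the comparator. -/
theorem sum_dot_leader_le {x K : ℕ → Mat n m} {stab : ℕ → ℝ}
    (hx : ∀ t, 1 ≤ t → IsLeader t (∑ s ∈ Finset.Icc 1 (t - 1), K s) (x t))
    (hstab : ∀ t, 1 ≤ t → ∀ y ∈ convexHull ℝ (actions n m), dot (x t - y) (K t)
      - √(t : ℝ) * ∑ i, ∑ j, (√(y i j) - √(x t i j)) ^ 2 / √(x t i j) ≤ stab t)
    (c : ℝ) (T : ℕ) {y : Mat n m} (hy : y ∈ convexHull ℝ (actions n m)) :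
    ∑ t ∈ Finset.Icc 1 T, dot (x t) (K t)
      ≤ dot y (∑ t ∈ Finset.Icc 1 T, K t) + 2 * √(T : ℝ) * (tsallis y - c)
        + ∑ t ∈ Finset.Icc 1 T,
          (stab t + 2 * (√(t : ℝ) - √((t : ℝ) - 1)) * (c - tsallis (x t))) := by
  induction T generalizing y with
  | zero => simp [dot]
  | succ T ih =>
    have ht : 1 ≤ T + 1 := Nat.le_add_left 1 T
    -- The bound up to round `T` is used against the next leader.
    have h1 := ih (hx (T + 1) ht).1
    have h2 := (hx (T + 1) ht).add_le ht hy
    have h3 := hstab (T + 1) ht y hy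
    simp only [Finset.sum_Icc_succ_top ht]
    simp only [Nat.add_sub_cancel] at h2
    rw [dot_sub_left] at h3
    rw [dot_add_right, show ((T + 1 : ℕ) : ℝ) - 1 = T by push_cast; ring]
    linarith

theorem exists_eq_ite_of_mem_actions {A : Mat n m} (hA : A ∈ actions n m) (j : Fin m) :
    ∃ k, ∀ i, A i j = if i = k then 1 else 0 := by
  obtain ⟨h01, hcol, -⟩ := hA
  have hk : ∃ k, A k j ≠ 0 := by
    by_contra! h
    simpa [h] using hcol j
  obtain ⟨k, hk⟩ := hk
  have hk1 := (h01 k j).resolve_left hk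
  refine ⟨k, fun i => ?_⟩
  split_ifs with h
  · rw [h, hk1]
  · have h1 := hcol j
    rw [← Finset.add_sum_erase Finset.univ _ (Finset.mem_univ k), hk1, add_eq_left,
      Finset.sum_eq_zero_iff_of_nonneg
        fun a _ => by rcases h01 a j with h | h <;> simp [h]] at h1
    exact h1 i (Finset.mem_erase.2 ⟨h, Finset.mem_univ i⟩)

theorem ite_eq_one_of_mem_actions {A : Mat n m} (hA : A ∈ actions n m) (i j) :
    (if A i j = 1 then (1 : ℝ) else 0) = A i j := by
  rcases hA.1 i j with h | h <;> simp [h]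

/-- Stability of a whole round with action `A` and losses `l`. The bound is linear in `A`, so its
expectation over the draw is obtained by replacing `A` with `x`. -/
theorem stability_le_sum_drawCost {t : ℕ} (ht : 1 ≤ t) {L x y l A : Mat n m}
    (hx : IsLeader t L x) (hy : y ∈ convexHull ℝ (actions n m)) (hA : A ∈ actions n m)
    (hl : ∀ i j, l i j = 0 ∨ l i j = 1) :
    dot (x - y) (fun i j => l i j * A i j / x i j)
        - √(t : ℝ) * ∑ i, ∑ j, (√(y i j) - √(x i j)) ^ 2 / √(x i j)
      ≤ ∑ j, ∑ i, A i j * (l i j * drawCost t (fun a => x a j) i) := by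
  rw [dot, Finset.sum_comm, Finset.sum_comm (s := Finset.univ (α := Fin n)) (f := fun i j =>
    (√(y i j) - √(x i j)) ^ 2 / √(x i j)), Finset.mul_sum, ← Finset.sum_sub_distrib]
  refine Finset.sum_le_sum fun j _ => ?_
  obtain ⟨k, hk⟩ := exists_eq_ite_of_mem_actions hA j
  have hB : 0 ≤ √(t : ℝ) * ∑ i, (√(y i j) - √(x i j)) ^ 2 / √(x i j) :=
    mul_nonneg (Real.sqrt_nonneg _) (Finset.sum_nonneg fun i _ => by positivity)
  simp only [hk, mul_ite, mul_one, mul_zero, ite_div, zero_div, ite_mul, one_mul, zero_mul,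
    Finset.sum_ite_eq', Finset.mem_univ, if_true, Pi.sub_apply]
  have hd := drawCost_nonneg t (fun a => x a j) k
  rcases hl k j with h | h
  · rw [h]
    simpa using hB
  · rw [h, one_mul, mul_one_div]
    by_cases hxk : x k j = 0
    · rw [hxk, div_zero]
      linarith
    · exact stability_le_drawCost ht (fun i => nonneg_of_mem_convexHull hx.1 i j)
        (sum_eq_one_of_mem_convexHull hx.1 j) (fun i => nonneg_of_mem_convexHull hy i j)
        (sum_eq_one_of_mem_convexHull hy j) (fun i h0 => hx.eq_zero_of_eq_zero ht hy h0) hxk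

theorem tsallis_of_mem_actions {A : Mat n m} (hA : A ∈ actions n m) : tsallis A = -(m : ℝ) := by
  have h : ∀ i j, -√(A i j) = -A i j := fun i j => by
    rcases hA.1 i j with h | h <;> simp [h]
  simp only [tsallis, h]
  rw [Finset.sum_comm]
  simp [hA.2.1]

theorem neg_card_sub_tsallis_le {x : Mat n m} (hx : x ∈ convexHull ℝ (actions n m))
    (Is : Fin m → Fin n) :
    -(m : ℝ) - tsallis x ≤ ∑ j, ∑ i ∈ Finset.univ.erase (Is j), √(x i j) := by
  have h : -tsallis x ≤ ∑ j, (1 + ∑ i ∈ Finset.univ.erase (Is j), √(x i j)) := by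
    simp only [tsallis, Finset.sum_neg_distrib, neg_neg]
    rw [Finset.sum_comm]
    refine Finset.sum_le_sum fun j _ => ?_
    rw [← Finset.add_sum_erase Finset.univ _ (Finset.mem_univ (Is j))]
    exact add_le_add_left (Real.sqrt_le_one.2 (le_one_of_mem_convexHull hx _ _)) _
  rw [Finset.sum_add_distrib, Finset.sum_const, Finset.card_univ, Fintype.card_fin, nsmul_one] at h
  linarith

end FTRL

/-! ### Finitely valued random variables -/

section FinitelyValued

variable {Ω E F : Type*}

/-- `Z` takes finitely many values, each on a set of the σ-algebra `G`. No σ-algebra on the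
codomain is involved, so the notion is stable under composition with arbitrary maps. -/
def FinitelyValued (G : MeasurableSpace Ω) (Z : Ω → E) : Prop :=
  (Set.range Z).Finite ∧ ∀ z, MeasurableSet[G] (Z ⁻¹' {z})

variable {G H : MeasurableSpace Ω} {Z : Ω → E} {W : Ω → F}

theorem FinitelyValued.measurableSet_preimage (hZ : FinitelyValued G Z) (s : Set E) :
    MeasurableSet[G] (Z ⁻¹' s) := by
  have e : Z ⁻¹' s = ⋃ z ∈ Set.range Z ∩ s, Z ⁻¹' {z} := by
    ext ω
    simp
  rw [e]
  exact (hZ.1.inter_of_left s).measurableSet_biUnion fun z _ => hZ.2 z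

theorem FinitelyValued.comp (hZ : FinitelyValued G Z) (φ : E → F) :
    FinitelyValued G (fun ω => φ (Z ω)) := by
  refine ⟨?_, fun w => hZ.measurableSet_preimage (φ ⁻¹' {w})⟩
  have e : Set.range (fun ω => φ (Z ω)) = φ '' Set.range Z := Set.range_comp φ Z
  rw [e]
  exact hZ.1.image φ

theorem FinitelyValued.prodMk (hZ : FinitelyValued G Z) (hW : FinitelyValued G W) :
    FinitelyValued G (fun ω => (Z ω, W ω)) := by
  refine ⟨(hZ.1.prod hW.1).subset ?_, fun p => ?_⟩
  · rintro _ ⟨ω, rfl⟩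
    exact ⟨⟨ω, rfl⟩, ⟨ω, rfl⟩⟩
  · have e : (fun ω => (Z ω, W ω)) ⁻¹' {p} = Z ⁻¹' {p.1} ∩ W ⁻¹' {p.2} := by
      ext ω
      simp [Prod.ext_iff]
    rw [e]
    exact (hZ.2 _).inter (hW.2 _)

theorem FinitelyValued.of_factorsThrough [Nonempty F] (hZ : FinitelyValued G Z)
    (h : W.FactorsThrough Z) : FinitelyValued G W := by
  obtain ⟨e, rfl⟩ := (Function.factorsThrough_iff W).1 h
  exact hZ.comp e

theorem FinitelyValued.mono (hZ : FinitelyValued G Z) (hGH : G ≤ H) : FinitelyValued H Z :=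
  ⟨hZ.1, fun z => hGH _ (hZ.2 z)⟩

theorem FinitelyValued.finsetSum {κ : Type*} [AddCommMonoid E] {s : Finset κ} {f : κ → Ω → E}
    (hf : ∀ k ∈ s, FinitelyValued G (f k)) : FinitelyValued G (fun ω => ∑ k ∈ s, f k ω) := by
  classical
  induction s using Finset.induction_on with
  | empty =>
    simp only [Finset.sum_empty]
    exact ⟨(Set.finite_singleton 0).subset (by rintro _ ⟨ω, rfl⟩; rfl),
      fun z => MeasurableSet.const _⟩
  | insert a s ha ih =>
    simp only [Finset.sum_insert ha]
    exact ((hf a (Finset.mem_insert_self a s)).prodMk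
      (ih fun k hk => hf k (Finset.mem_insert_of_mem hk))).comp fun p => p.1 + p.2

theorem FinitelyValued.stronglyMeasurable {f : Ω → ℝ} (hf : FinitelyValued G f) :
    StronglyMeasurable[G] f :=
  Measurable.stronglyMeasurable fun s _ => hf.measurableSet_preimage s

theorem FinitelyValued.integrable [mΩ : MeasurableSpace Ω] {μ : Measure Ω} [IsFiniteMeasure μ]
    {f : Ω → ℝ} (hf : FinitelyValued mΩ f) : Integrable f μ := by
  obtain ⟨C, hC⟩ := (hf.1.image fun a => ‖a‖).bddAbove
  exact Integrable.of_bound hf.stronglyMeasurable.aestronglyMeasurable C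
    (Filter.Eventually.of_forall fun ω => hC ⟨f ω, ⟨ω, rfl⟩, rfl⟩)

end FinitelyValued

/-! ### Measurability and fresh randomness of a run -/

section Run

variable {Ω : Type*} {n m : ℕ} {ℓ : ℕ → Ω → Mat n m} {X : ℕ → Ω → actions n m}

theorem finitelyValued_action {s t : ℕ} (hs : 1 ≤ s) (hst : s < t) :
    FinitelyValued (beforeDraw ℓ X t) (X s) := by
  refine ⟨Set.toFinite _, fun z => ?_⟩
  have hle : MeasurableSpace.comap (X s) inferInstance ≤ beforeDraw ℓ X t :=
    le_sup_of_le_right (le_iSup₂_of_le s (Finset.mem_Ico.2 ⟨hs, hst⟩) le_rfl)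
  exact hle _ ⟨{z}, measurableSet_singleton z, rfl⟩

theorem beforeDraw_mono : Monotone (beforeDraw ℓ X) := by
  intro s t hst
  exact sup_le_sup
    (biSup_mono fun a ha => Finset.Icc_subset_Icc_right hst ha)
    (biSup_mono fun a ha => Finset.Ico_subset_Ico_right hst ha)

variable [mΩ : MeasurableSpace Ω] {μ : Measure Ω}
  {P : Mat n m → PMF (actions n m)} {x : ℕ → Ω → Mat n m}

theorem IsRun.beforeDraw_le (h : IsRun μ P ℓ X x) (t : ℕ) : beforeDraw ℓ X t ≤ mΩ := by
  refine sup_le (iSup₂_le fun s hs => ?_) (iSup₂_le fun s hs => ?_)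
  · exact (h.measurable_loss s (Finset.mem_Icc.1 hs).1).comap_le
  · exact (h.measurable_action s (Finset.mem_Ico.1 hs).1).comap_le

theorem IsRun.finite_range_loss (h : IsRun μ P ℓ X x) {t : ℕ} (ht : 1 ≤ t) :
    (Set.range (ℓ t)).Finite := by
  have hfin : (Set.univ.pi fun _ : Fin n => Set.univ.pi fun _ : Fin m =>
      ({0, 1} : Set ℝ)).Finite :=
    Set.Finite.pi fun _ => Set.Finite.pi fun _ => Set.toFinite _
  refine hfin.subset ?_
  rintro _ ⟨ω, rfl⟩ i _ j _
  exact h.loss_binary t ht ω i j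

theorem IsRun.finitelyValued_loss (h : IsRun μ P ℓ X x) {s t : ℕ} (hs : 1 ≤ s) (hst : s ≤ t) :
    FinitelyValued (beforeDraw ℓ X t) (ℓ s) := by
  refine ⟨h.finite_range_loss hs, fun z => ?_⟩
  have hle : MeasurableSpace.comap (ℓ s) inferInstance ≤ beforeDraw ℓ X t :=
    le_sup_of_le_left (le_iSup₂_of_le s (Finset.mem_Icc.2 ⟨hs, hst⟩) le_rfl)
  exact hle _ ⟨{z}, measurableSet_singleton z, rfl⟩

/-- Leaders are unique, so `x_t` is a function of the past losses and actions. -/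
theorem IsRun.finitelyValued_leader (h : IsRun μ P ℓ X x) {t : ℕ} (ht : 1 ≤ t) :
    FinitelyValued (beforeDraw ℓ X t) (x t) := by
  induction t using Nat.strong_induction_on with
  | _ t ih =>
    have hL : FinitelyValued (beforeDraw ℓ X t) (cumLossEst ℓ X x (t - 1)) := by
      refine FinitelyValued.finsetSum fun s hs => ?_
      obtain ⟨hs1, hs2⟩ := Finset.mem_Icc.1 hs
      have hst : s < t := by omega
      exact (((h.finitelyValued_loss hs1 hst.le).prodMk (finitelyValued_action hs1 hst)).prodMk
        ((ih s hst hs1).mono (beforeDraw_mono hst.le))).comp fun z i j =>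
          z.1.1 i j * (if (z.1.2 : Mat n m) i j = 1 then 1 else 0) / z.2 i j
    refine hL.of_factorsThrough fun ω ω' hω => ?_
    have h1 := h.leader t ht ω
    rw [hω] at h1
    exact h1.unique ht (h.leader t ht ω')

/-- The loss, the action and the leader of one round, jointly. -/
theorem IsRun.finitelyValued_round (h : IsRun μ P ℓ X x) {t : ℕ} (ht : 1 ≤ t) :
    FinitelyValued mΩ (fun ω => (ℓ t ω, X t ω, x t ω)) :=
  ((h.finitelyValued_loss ht le_rfl).mono (h.beforeDraw_le t)).prodMk
    (((finitelyValued_action ht t.lt_succ_self).mono (h.beforeDraw_le (t + 1))).prodMk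
      ((h.finitelyValued_leader ht).mono (h.beforeDraw_le t)))

/-- Fresh randomness: `X_t` may be replaced by `x_t` in expectations against anything known before
the draw. -/
theorem IsRun.integral_action_mul [IsProbabilityMeasure μ] (h : IsRun μ P ℓ X x)
    (hP : IsSamplingRule P) {t : ℕ} (ht : 1 ≤ t) {W : Ω → ℝ}
    (hW : FinitelyValued (beforeDraw ℓ X t) W) (i : Fin n) (j : Fin m) :
    ∫ ω, (X t ω : Mat n m) i j * W ω ∂μ = ∫ ω, x t ω i j * W ω ∂μ := by
  have hG := h.beforeDraw_le t
  have hX : FinitelyValued mΩ (X t) := (h.finitelyValued_round ht).comp fun z => z.2.1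
  have hWm := hW.mono hG
  have hx := (h.finitelyValued_leader ht).mono hG
  have hind : ∀ A : actions n m,
      FinitelyValued mΩ (Set.indicator {ω | X t ω = A} (fun _ => (1 : ℝ))) := fun A => by
    classical
    have e : Set.indicator {ω | X t ω = A} (fun _ => (1 : ℝ))
        = fun ω => if X t ω = A then (1 : ℝ) else 0 := by
      ext ω
      simp [Set.indicator_apply]
    rw [e]
    exact hX.comp fun B => if B = A then (1 : ℝ) else 0
  have key : ∀ A : actions n m,
      ∫ ω, Set.indicator {ω | X t ω = A} (fun _ => (1 : ℝ)) ω * W ω ∂μ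
        = ∫ ω, (P (x t ω) A).toReal * W ω ∂μ := by
    intro A
    have hint : Integrable (Set.indicator {ω | X t ω = A} (fun _ => (1 : ℝ)) * W) μ :=
      (((hind A).prodMk hWm).comp fun p => p.1 * p.2).integrable
    have h1 := condExp_mul_of_stronglyMeasurable_right hW.stronglyMeasurable hint
      (hind A).integrable
    calc _ = ∫ ω, (μ[Set.indicator {ω | X t ω = A} (fun _ => (1 : ℝ)) * W | beforeDraw ℓ X t]) ω
            ∂μ := (integral_condExp hG).symm
      _ = _ := by
        refine integral_congr_ae ?_
        filter_upwards [h1, h.sample t ht A] with ω h1 h2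
        rw [h1, Pi.mul_apply, h2]
  calc ∫ ω, (X t ω : Mat n m) i j * W ω ∂μ
      = ∫ ω, ∑ A : actions n m, (A : Mat n m) i j *
          (Set.indicator {ω | X t ω = A} (fun _ => (1 : ℝ)) ω * W ω) ∂μ := by
        congr with ω
        classical
        simp [Set.indicator_apply]
    _ = ∑ A : actions n m, (A : Mat n m) i j *
          ∫ ω, Set.indicator {ω | X t ω = A} (fun _ => (1 : ℝ)) ω * W ω ∂μ := by
        rw [integral_finsetSum _ fun A _ =>
          (((hind A).prodMk hWm).comp fun p => (A : Mat n m) i j * (p.1 * p.2)).integrable]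
        simp only [integral_const_mul]
    _ = ∑ A : actions n m, (A : Mat n m) i j * ∫ ω, (P (x t ω) A).toReal * W ω ∂μ := by
        simp only [key]
    _ = ∫ ω, ∑ A : actions n m, (A : Mat n m) i j * ((P (x t ω) A).toReal * W ω) ∂μ := by
        rw [integral_finsetSum _ fun (A : actions n m) _ => ((hx.prodMk hWm).comp fun p =>
          (A : Mat n m) i j * ((P p.1 A).toReal * p.2)).integrable]
        simp only [integral_const_mul]
    _ = ∫ ω, x t ω i j * W ω ∂μ := by
        congr with ω
        rw [← hP _ (h.leader t ht ω).1 i j, Finset.sum_mul]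
        exact Finset.sum_congr rfl fun A _ => by ring

end Run

/-! ### The regret bound -/

section Regret

variable {Ω : Type*} {n m : ℕ} {ℓ : ℕ → Ω → Mat n m} {X : ℕ → Ω → actions n m}
  {x : ℕ → Ω → Mat n m}

theorem lossEst_eq (t : ℕ) (ω : Ω) :
    lossEst ℓ X x t ω = fun i j => ℓ t ω i j * (X t ω : Mat n m) i j / x t ω i j := by
  ext i j
  rw [lossEst, ite_eq_one_of_mem_actions (X t ω).2]

variable [mΩ : MeasurableSpace Ω] {μ : Measure Ω} {P : Mat n m → PMF (actions n m)}

/-- The estimated regret of a round has at least the expectation of the true regret. At an entry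
with `x = 0` the estimate is `0`, which can only underestimate the loss of the comparator. -/
theorem IsRun.integral_dot_le [IsProbabilityMeasure μ] (h : IsRun μ P ℓ X x)
    (hP : IsSamplingRule P) {xs : Mat n m} (hxs : xs ∈ actions n m) {t : ℕ} (ht : 1 ≤ t) :
    ∫ ω, dot ((X t ω : Mat n m) - xs) (ℓ t ω) ∂μ
      ≤ ∫ ω, dot (x t ω - xs) (lossEst ℓ X x t ω) ∂μ := by
  have hZ := h.finitelyValued_round ht
  have hB := (h.finitelyValued_loss ht le_rfl).prodMk (h.finitelyValued_leader ht)
  simp only [dot, lossEst_eq]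
  rw [integral_finsetSum _ fun i _ => (hZ.comp fun z => ∑ j, ((z.2.1 : Mat n m) - xs) i j *
      z.1 i j).integrable,
    integral_finsetSum _ fun i _ => (hZ.comp fun z => ∑ j, (z.2.2 - xs) i j *
      (z.1 i j * (z.2.1 : Mat n m) i j / z.2.2 i j)).integrable]
  refine Finset.sum_le_sum fun i _ => ?_
  rw [integral_finsetSum _ fun j _ => (hZ.comp fun z => ((z.2.1 : Mat n m) - xs) i j *
      z.1 i j).integrable,
    integral_finsetSum _ fun j _ => (hZ.comp fun z => (z.2.2 - xs) i j *
      (z.1 i j * (z.2.1 : Mat n m) i j / z.2.2 i j)).integrable]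
  refine Finset.sum_le_sum fun j _ => ?_
  calc ∫ ω, ((X t ω : Mat n m) - xs) i j * ℓ t ω i j ∂μ
      = ∫ ω, (X t ω : Mat n m) i j * ℓ t ω i j ∂μ - ∫ ω, xs i j * ℓ t ω i j ∂μ := by
        rw [← integral_sub (hZ.comp fun z => (z.2.1 : Mat n m) i j * z.1 i j).integrable
          (hZ.comp fun z => xs i j * z.1 i j).integrable]
        simp only [Pi.sub_apply, sub_mul]
    _ = ∫ ω, x t ω i j * ℓ t ω i j ∂μ - ∫ ω, xs i j * ℓ t ω i j ∂μ := by
        rw [h.integral_action_mul hP ht (hB.comp fun z => z.1 i j)]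
    _ = ∫ ω, (x t ω i j - xs i j) * ℓ t ω i j ∂μ := by
        rw [← integral_sub (hZ.comp fun z => z.2.2 i j * z.1 i j).integrable
          (hZ.comp fun z => xs i j * z.1 i j).integrable]
        simp only [sub_mul]
    _ ≤ ∫ ω, x t ω i j * ((x t ω i j - xs i j) * (ℓ t ω i j / x t ω i j)) ∂μ := by
        refine integral_mono (hZ.comp fun z => (z.2.2 i j - xs i j) * z.1 i j).integrable
          (hZ.comp fun z =>
            z.2.2 i j * ((z.2.2 i j - xs i j) * (z.1 i j / z.2.2 i j))).integrable fun ω => ?_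
        by_cases h0 : x t ω i j = 0
        · have h1 : 0 ≤ ℓ t ω i j := by
            rcases h.loss_binary t ht ω i j with h | h <;> simp [h]
          have h2 : 0 ≤ xs i j := by rcases hxs.1 i j with h | h <;> simp [h]
          simp only [h0, zero_sub, zero_mul]
          linarith [mul_nonneg h2 h1]
        · refine le_of_eq ?_
          simp only
          field_simp
    _ = ∫ ω, (X t ω : Mat n m) i j * ((x t ω i j - xs i j) * (ℓ t ω i j / x t ω i j)) ∂μ := by
        rw [h.integral_action_mul hP ht
          (hB.comp fun z => (z.2 i j - xs i j) * (z.1 i j / z.2 i j))]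
    _ = ∫ ω, (x t ω - xs) i j * (ℓ t ω i j * (X t ω : Mat n m) i j / x t ω i j) ∂μ := by
        congr with ω
        simp only [Pi.sub_apply]
        ring

/-- Expected stability and penalty of one round. -/
theorem IsRun.integral_round_le [IsProbabilityMeasure μ] (h : IsRun μ P ℓ X x)
    (hP : IsSamplingRule P) (Is : Fin m → Fin n) {t : ℕ} (ht : 1 ≤ t) :
    ∫ ω, (∑ j, ∑ i, (X t ω : Mat n m) i j * (ℓ t ω i j * drawCost t (fun a => x t ω a j) i)
        + 2 * (√(t : ℝ) - √((t : ℝ) - 1)) * (-(m : ℝ) - tsallis (x t ω))) ∂μ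
      ≤ 3 / √(t : ℝ) * ∑ j : Fin m, ∑ i ∈ Finset.univ.erase (Is j), √(∫ ω, x t ω i j ∂μ)
        + 2 * m / t := by
  have hZ := h.finitelyValued_round ht
  have hB := (h.finitelyValued_loss ht le_rfl).prodMk (h.finitelyValued_leader ht)
  have hx := fun ω => (h.leader t ht ω).1
  have hpen : 0 ≤ 2 * (√(t : ℝ) - √((t : ℝ) - 1)) := by
    have := Real.sqrt_le_sqrt (show (t : ℝ) - 1 ≤ t by linarith)
    linarith
  have hint : ∫ ω, ∑ j, ∑ i, (X t ω : Mat n m) i j *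
        (ℓ t ω i j * drawCost t (fun a => x t ω a j) i) ∂μ
      = ∫ ω, ∑ j, ∑ i, x t ω i j * (ℓ t ω i j * drawCost t (fun a => x t ω a j) i) ∂μ := by
    rw [integral_finsetSum _ fun j _ => (hZ.comp fun z => ∑ i, (z.2.1 : Mat n m) i j *
        (z.1 i j * drawCost t (fun a => z.2.2 a j) i)).integrable,
      integral_finsetSum _ fun j _ => (hZ.comp fun z => ∑ i, z.2.2 i j *
        (z.1 i j * drawCost t (fun a => z.2.2 a j) i)).integrable]
    refine Finset.sum_congr rfl fun j _ => ?_
    rw [integral_finsetSum _ fun i _ => (hZ.comp fun z => (z.2.1 : Mat n m) i j *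
        (z.1 i j * drawCost t (fun a => z.2.2 a j) i)).integrable,
      integral_finsetSum _ fun i _ => (hZ.comp fun z => z.2.2 i j *
        (z.1 i j * drawCost t (fun a => z.2.2 a j) i)).integrable]
    exact Finset.sum_congr rfl fun i _ => h.integral_action_mul hP ht
      (hB.comp fun z => z.1 i j * drawCost t (fun a => z.2 a j) i) i j
  have hjensen : ∀ i j, ∫ ω, √(x t ω i j) ∂μ ≤ √(∫ ω, x t ω i j ∂μ) := fun i j =>
    Real.strictConcaveOn_sqrt.concaveOn.le_map_integral Real.continuous_sqrt.continuousOn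
      isClosed_Ici (Filter.Eventually.of_forall fun ω => nonneg_of_mem_convexHull (hx ω) i j)
      (hZ.comp fun z => z.2.2 i j).integrable (hZ.comp fun z => √(z.2.2 i j)).integrable
  calc _ = ∫ ω, (∑ j, ∑ i, x t ω i j * (ℓ t ω i j * drawCost t (fun a => x t ω a j) i)
        + 2 * (√(t : ℝ) - √((t : ℝ) - 1)) * (-(m : ℝ) - tsallis (x t ω))) ∂μ := by
        rw [integral_add (hZ.comp fun z => ∑ j, ∑ i, (z.2.1 : Mat n m) i j *
            (z.1 i j * drawCost t (fun a => z.2.2 a j) i)).integrable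
          (hZ.comp fun z => 2 * (√(t : ℝ) - √((t : ℝ) - 1)) *
            (-(m : ℝ) - tsallis z.2.2)).integrable, hint,
          ← integral_add (hZ.comp fun z => ∑ j, ∑ i, z.2.2 i j *
            (z.1 i j * drawCost t (fun a => z.2.2 a j) i)).integrable
          (hZ.comp fun z => 2 * (√(t : ℝ) - √((t : ℝ) - 1)) *
            (-(m : ℝ) - tsallis z.2.2)).integrable]
    _ ≤ ∫ ω, (3 / √(t : ℝ) * (∑ j : Fin m, ∑ i ∈ Finset.univ.erase (Is j), √(x t ω i j))
          + 2 * m / t) ∂μ := by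
        refine integral_mono (hZ.comp fun z => ∑ j, ∑ i, z.2.2 i j *
            (z.1 i j * drawCost t (fun a => z.2.2 a j) i) + 2 * (√(t : ℝ) - √((t : ℝ) - 1)) *
            (-(m : ℝ) - tsallis z.2.2)).integrable
          (hZ.comp fun z => 3 / √(t : ℝ) * (∑ j : Fin m, ∑ i ∈ Finset.univ.erase (Is j),
            √(z.2.2 i j)) + 2 * m / t).integrable fun ω => ?_
        have h1 := mul_le_mul_of_nonneg_left (neg_card_sub_tsallis_le (hx ω) Is) hpen
        have h2 : ∑ j, ∑ i, x t ω i j * (ℓ t ω i j * drawCost t (fun a => x t ω a j) i)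
            ≤ ∑ j, ∑ i, x t ω i j * drawCost t (fun a => x t ω a j) i := by
          refine Finset.sum_le_sum fun j _ => Finset.sum_le_sum fun i _ =>
            mul_le_mul_of_nonneg_left ?_ (nonneg_of_mem_convexHull (hx ω) i j)
          have h3 := drawCost_nonneg t (fun a => x t ω a j) i
          rcases h.loss_binary t ht ω i j with h | h <;> simp [h, h3]
        have h4 := Finset.sum_le_sum fun j (_ : j ∈ Finset.univ) =>
          sum_mul_drawCost_add_penalty_le ht
            (fun i => nonneg_of_mem_convexHull (hx ω) i j)
            (sum_eq_one_of_mem_convexHull (hx ω) j) (Is j)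
        rw [Finset.sum_add_distrib, ← Finset.mul_sum, Finset.sum_add_distrib, ← Finset.mul_sum,
          Finset.sum_const, Finset.card_univ, Fintype.card_fin, nsmul_eq_mul] at h4
        have h5 : (m : ℝ) * (2 / t) = 2 * m / t := by ring
        simp only
        linarith
    _ = 3 / √(t : ℝ) * (∑ j : Fin m, ∑ i ∈ Finset.univ.erase (Is j), ∫ ω, √(x t ω i j) ∂μ)
          + 2 * m / t := by
        rw [integral_add (hZ.comp fun z => 3 / √(t : ℝ) * (∑ j : Fin m,
            ∑ i ∈ Finset.univ.erase (Is j), √(z.2.2 i j))).integrable (integrable_const _),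
          integral_const_mul, integral_const, probReal_univ, one_smul,
          integral_finsetSum _ fun j _ => (hZ.comp fun z =>
            ∑ i ∈ Finset.univ.erase (Is j), √(z.2.2 i j)).integrable]
        congr 2
        exact Finset.sum_congr rfl fun j _ => integral_finsetSum _ fun i _ =>
          (hZ.comp fun z => √(z.2.2 i j)).integrable
    _ ≤ _ := by
        gcongr with j _ i _
        exact hjensen i j

theorem sum_one_div_le (T : ℕ) : ∑ t ∈ Finset.Icc 1 T, (1 : ℝ) / t ≤ 1 + Real.log T := by
  have h := harmonic_le_one_add_log T
  rw [harmonic_eq_sum_Icc] at h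
  push_cast at h
  simpa only [one_div] using h

theorem IsRun.regret_le [IsProbabilityMeasure μ] (h : IsRun μ P ℓ X x) (hP : IsSamplingRule P)
    {xs : Mat n m} (hxs : xs ∈ actions n m) (Is : Fin m → Fin n) (T : ℕ) :
    regret μ ℓ X xs T ≤ regretBound μ x Is T := by
  have one_le : ∀ {t}, t ∈ Finset.Icc 1 T → 1 ≤ t := fun ht => (Finset.mem_Icc.1 ht).1
  have hftrl : ∀ ω, ∑ t ∈ Finset.Icc 1 T, dot (x t ω - xs) (lossEst ℓ X x t ω)
      ≤ ∑ t ∈ Finset.Icc 1 T,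
        (∑ j, ∑ i, (X t ω : Mat n m) i j * (ℓ t ω i j * drawCost t (fun a => x t ω a j) i)
          + 2 * (√(t : ℝ) - √((t : ℝ) - 1)) * (-(m : ℝ) - tsallis (x t ω))) := by
    intro ω
    have h1 := sum_dot_leader_le (x := fun t => x t ω) (K := fun t => lossEst ℓ X x t ω)
      (stab := fun t => ∑ j, ∑ i, (X t ω : Mat n m) i j *
        (ℓ t ω i j * drawCost t (fun a => x t ω a j) i))
      (fun t ht => h.leader t ht ω)
      (fun t ht y hy => by
        rw [lossEst_eq]
        exact stability_le_sum_drawCost ht (h.leader t ht ω) hy (X t ω).2 (h.loss_binary t ht ω))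
      (-(m : ℝ)) T (subset_convexHull ℝ _ hxs)
    have h2 : dot xs (∑ t ∈ Finset.Icc 1 T, lossEst ℓ X x t ω)
        = ∑ t ∈ Finset.Icc 1 T, dot xs (lossEst ℓ X x t ω) := by
      induction Finset.Icc 1 T using Finset.induction_on with
      | empty => simp [dot]
      | insert a s ha ih => rw [Finset.sum_insert ha, Finset.sum_insert ha, dot_add_right, ih]
    rw [tsallis_of_mem_actions hxs, sub_self, mul_zero, add_zero, h2] at h1
    simp only [dot_sub_left, Finset.sum_sub_distrib]
    linarith
  have hZ := fun {t} (ht : t ∈ Finset.Icc 1 T) => h.finitelyValued_round (one_le ht)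
  calc regret μ ℓ X xs T
      = ∑ t ∈ Finset.Icc 1 T, ∫ ω, dot ((X t ω : Mat n m) - xs) (ℓ t ω) ∂μ :=
        integral_finsetSum _ fun t ht =>
          ((hZ ht).comp fun z => dot ((z.2.1 : Mat n m) - xs) z.1).integrable
    _ ≤ ∑ t ∈ Finset.Icc 1 T, ∫ ω, dot (x t ω - xs) (lossEst ℓ X x t ω) ∂μ :=
        Finset.sum_le_sum fun t ht => h.integral_dot_le hP hxs (one_le ht)
    _ = ∫ ω, ∑ t ∈ Finset.Icc 1 T, dot (x t ω - xs) (lossEst ℓ X x t ω) ∂μ := by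
        simp only [lossEst_eq]
        exact (integral_finsetSum _ fun t ht => ((hZ ht).comp fun z => dot (z.2.2 - xs)
          fun i j => z.1 i j * (z.2.1 : Mat n m) i j / z.2.2 i j).integrable).symm
    _ ≤ ∫ ω, ∑ t ∈ Finset.Icc 1 T,
        (∑ j, ∑ i, (X t ω : Mat n m) i j * (ℓ t ω i j * drawCost t (fun a => x t ω a j) i)
          + 2 * (√(t : ℝ) - √((t : ℝ) - 1)) * (-(m : ℝ) - tsallis (x t ω))) ∂μ := by
        simp only [lossEst_eq] at hftrl ⊢
        exact integral_mono
          (FinitelyValued.finsetSum fun t ht => (hZ ht).comp fun z => dot (z.2.2 - xs)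
            fun i j => z.1 i j * (z.2.1 : Mat n m) i j / z.2.2 i j).integrable
          (FinitelyValued.finsetSum fun t ht => (hZ ht).comp fun z =>
            ∑ j, ∑ i, (z.2.1 : Mat n m) i j * (z.1 i j * drawCost t (fun a => z.2.2 a j) i)
            + 2 * (√(t : ℝ) - √((t : ℝ) - 1)) * (-(m : ℝ) - tsallis z.2.2)).integrable hftrl
    _ = ∑ t ∈ Finset.Icc 1 T, ∫ ω,
        (∑ j, ∑ i, (X t ω : Mat n m) i j * (ℓ t ω i j * drawCost t (fun a => x t ω a j) i)
          + 2 * (√(t : ℝ) - √((t : ℝ) - 1)) * (-(m : ℝ) - tsallis (x t ω))) ∂μ :=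
        integral_finsetSum _ fun t ht => ((hZ ht).comp fun z =>
            ∑ j, ∑ i, (z.2.1 : Mat n m) i j * (z.1 i j * drawCost t (fun a => z.2.2 a j) i)
            + 2 * (√(t : ℝ) - √((t : ℝ) - 1)) * (-(m : ℝ) - tsallis z.2.2)).integrable
    _ ≤ ∑ t ∈ Finset.Icc 1 T, (3 / √(t : ℝ) *
          ∑ j : Fin m, ∑ i ∈ Finset.univ.erase (Is j), √(∫ ω, x t ω i j ∂μ) + 2 * m / t) :=
        Finset.sum_le_sum fun t ht => h.integral_round_le hP Is (one_le ht)
    _ ≤ regretBound μ x Is T := by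
        have h1 := mul_le_mul_of_nonneg_left (sum_one_div_le T)
          (show (0 : ℝ) ≤ 2 * m by positivity)
        rw [Finset.mul_sum] at h1
        simp only [mul_one_div] at h1
        rw [Finset.sum_add_distrib, regretBound]
        have : (0 : ℝ) ≤ m := Nat.cast_nonneg m
        linarith

theorem sum_one_div_sqrt_le (T : ℕ) : ∑ t ∈ Finset.Icc 1 T, 1 / √(t : ℝ) ≤ 2 * √(T : ℝ) := by
  induction T with
  | zero => simp
  | succ T ih =>
    rw [Finset.sum_Icc_succ_top (Nat.le_add_left 1 T)]
    have hq : 0 ≤ √(T : ℝ) := Real.sqrt_nonneg _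
    have hq2 : √(T : ℝ) ^ 2 = T := Real.sq_sqrt (Nat.cast_nonneg T)
    have hr2 : √((T + 1 : ℕ) : ℝ) ^ 2 = T + 1 := by
      rw [Real.sq_sqrt (Nat.cast_nonneg _)]
      push_cast
      rfl
    have hr : 0 < √((T + 1 : ℕ) : ℝ) := Real.sqrt_pos.2 (by positivity)
    set q := √(T : ℝ)
    set r := √((T + 1 : ℕ) : ℝ)
    have h1 : 1 / r ≤ 2 * r - 2 * q := by
      rw [div_le_iff₀ hr]
      nlinarith [sq_nonneg (r - q)]
    linarith

/-- The constant is `13 = 3 + 4 + 6`, from `3 m`, from `log T ≤ 2 √T`, and from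
`∑ 3 / √t ≤ 6 √T` with every inner sum at most `√n`. -/
theorem IsRun.regretBound_le [IsProbabilityMeasure μ] (h : IsRun μ P ℓ X x) (hmn : m ≤ n)
    (Is : Fin m → Fin n) {T : ℕ} (hT : 1 ≤ T) :
    regretBound μ x Is T ≤ 13 * (m * √((n : ℝ) * (T : ℝ))) := by
  rcases Nat.eq_zero_or_pos m with rfl | hm
  · simp [regretBound]
  have hT' : (1 : ℝ) ≤ T := by exact_mod_cast hT
  have hm' : (0 : ℝ) ≤ m := Nat.cast_nonneg m
  have hn1 : 1 ≤ √(n : ℝ) := Real.one_le_sqrt.2 (by exact_mod_cast hm.trans_le hmn)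
  have hT1 : 1 ≤ √(T : ℝ) := Real.one_le_sqrt.2 hT'
  have hlog : Real.log T ≤ 2 * √(T : ℝ) := by
    have h1 := Real.log_le_sub_one_of_pos (x := √(T : ℝ)) (by linarith)
    rw [Real.log_sqrt (by linarith)] at h1
    linarith
  have hcol : ∀ t ∈ Finset.Icc 1 T, ∑ j : Fin m, ∑ i ∈ Finset.univ.erase (Is j),
      √(∫ ω, x t ω i j ∂μ) ≤ m * √(n : ℝ) := by
    intro t ht
    have ht1 := (Finset.mem_Icc.1 ht).1
    have hZ := h.finitelyValued_round ht1
    have hj : ∀ j ∈ (Finset.univ : Finset (Fin m)),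
        ∑ i ∈ Finset.univ.erase (Is j), √(∫ ω, x t ω i j ∂μ) ≤ √(n : ℝ) := by
      intro j _
      have h0 : ∀ i, 0 ≤ ∫ ω, x t ω i j ∂μ := fun i =>
        integral_nonneg fun ω => nonneg_of_mem_convexHull (h.leader t ht1 ω).1 i j
      have hsum : ∑ i, ∫ ω, x t ω i j ∂μ = 1 := by
        rw [← integral_finsetSum _ fun i _ => (hZ.comp fun z => z.2.2 i j).integrable]
        simp [sum_eq_one_of_mem_convexHull (h.leader t ht1 _).1 j]
      refine (Finset.sum_le_sum_of_subset_of_nonneg (Finset.erase_subset _ _)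
        fun i _ _ => Real.sqrt_nonneg _).trans (Real.le_sqrt_of_sq_le ?_)
      refine (sq_sum_le_card_mul_sum_sq).trans (le_of_eq ?_)
      simp only [Real.sq_sqrt (h0 _), hsum, Finset.card_univ, Fintype.card_fin, mul_one]
    simpa using Finset.sum_le_sum hj
  have hsum : ∑ t ∈ Finset.Icc 1 T, 3 / √(t : ℝ) *
      ∑ j : Fin m, ∑ i ∈ Finset.univ.erase (Is j), √(∫ ω, x t ω i j ∂μ)
      ≤ 6 * (m * (√(n : ℝ) * √(T : ℝ))) := by
    calc _ ≤ ∑ t ∈ Finset.Icc 1 T, 3 * (m * √(n : ℝ)) * (1 / √(t : ℝ)) := by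
          refine Finset.sum_le_sum fun t ht => ?_
          refine (mul_le_mul_of_nonneg_left (hcol t ht) (by positivity)).trans (le_of_eq ?_)
          ring
      _ ≤ 3 * (m * √(n : ℝ)) * (2 * √(T : ℝ)) := by
          rw [← Finset.mul_sum]
          exact mul_le_mul_of_nonneg_left (sum_one_div_sqrt_le T) (by positivity)
      _ = _ := by ring
  have hnT : √(T : ℝ) ≤ √(n : ℝ) * √(T : ℝ) := le_mul_of_one_le_left (by linarith) hn1
  have h1 : (m : ℝ) * 1 ≤ m * (√(n : ℝ) * √(T : ℝ)) :=
    mul_le_mul_of_nonneg_left (hT1.trans hnT) hm'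
  have h2 : (m : ℝ) * Real.log T ≤ m * (2 * (√(n : ℝ) * √(T : ℝ))) :=
    mul_le_mul_of_nonneg_left (hlog.trans (by linarith)) hm'
  rw [regretBound, Real.sqrt_mul (Nat.cast_nonneg n)]
  linarith

end Regret

end PBM

theorem theorem1 :
    ∃ C : ℝ, ∀ (n m : ℕ), m ≤ n →
      ∀ (Ω : Type*) [MeasurableSpace Ω] (μ : Measure Ω) [IsProbabilityMeasure μ]
        (P : PBM.Mat n m → PMF (PBM.actions n m)), PBM.IsSamplingRule P →
      ∀ (ℓ : ℕ → Ω → PBM.Mat n m) (X : ℕ → Ω → PBM.actions n m) (x : ℕ → Ω → PBM.Mat n m),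
        PBM.IsRun μ P ℓ X x →
      ∀ (T : ℕ), 1 ≤ T →
      ∀ (xs : PBM.Mat n m), PBM.IsBestAction μ ℓ T xs →
      ∀ (Is : Fin m → Fin n), (∀ j, xs (Is j) j = 1) →
        PBM.regret μ ℓ X xs T ≤ PBM.regretBound μ x Is T ∧
        PBM.regretBound μ x Is T ≤ C * (m * √((n : ℝ) * (T : ℝ))) := by
  refine ⟨13, fun n m hmn Ω _ μ _ P hP ℓ X x hrun T hT xs hxs Is _ => ⟨?_, ?_⟩⟩
  · exact hrun.regret_le hP hxs.1 Is T
  · exact hrun.regretBound_le hmn Is hT
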